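/- Let $R$ be a commutative Noetherian ring with non-zero identity, $I$ a proper ideal of $R$, and $M, N$ a pair of $R$-modules with $M$ finitely generated ($N$ is arbitrary). For $R$-modules $A, B$ and an integer $i\ge 0$ let $$H^i_I(A,B)=\varinjlim_{q}\operatorname{Ext}^i_R(A/I^qA,B)$$ be the generalized local cohomology modules (the transition maps being induced by the natural surjections $A/I^{q+1}A\to A/I^qA$), and put $$\operatorname{depth}_I(A,B)=\inf\{i\ge 0\mid H^i_I(A,B)\ne 0\},\qquad \operatorname{cd}_I(A,B)=\sup\{i\ge 0\mid H^i_I(A,B)\ne 0\},$$ with the conventions $\inf\emptyset=\infty$ and $\sup\emptyset=-\infty$. Write $H^i_I(B)=H^i_I(R,B)$, $\operatorname{depth}_I B=\operatorname{depth}_I(R,B)$ and $\operatorname{cd}_I B=\operatorname{cd}_I(R,B)$ for the ordinary local cohomology, depth and cohomological dimension. The module $B$ is called Cohen–Macaulay with respect to $I$ if $\operatorname{depth}_I B=\operatorname{cd}_I B$, and $A,B$ is called a Cohen–Macaulay pair with respect to $I$ if $\operatorname{depth}_I(A,B)=\operatorname{cd}_I(A,B)$. **Proposition.** Suppose that there is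 a non-negative integer $e$ with $\operatorname{Ext}^i_R(M,N)=0$ for all $i\ne e$. Then $$\operatorname{depth}_I(M,N)=\operatorname{depth}_I\operatorname{Ext}^e_R(M,N)+e\quad\text{and}\quad \operatorname{cd}_I(M,N)=\operatorname{cd}_I\operatorname{Ext}^e_R(M,N)+e.$$ In this case, $\operatorname{Ext}^e_R(M,N)$ is Cohen–Macaulay with respect to $I$ if and only if $M,N$ is a Cohen–Macaulay pair with respect to $I$. -/

import Mathlib

universe u

open CategoryTheory

noncomputable section

namespace GenLocalCohomology

/-- The `R`-module `Ext^i_R(M, N)`. -/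
abbrev ExtModule (R : Type u) [CommRing R] (M N : Type u) [AddCommGroup M] [Module R M]
    [AddCommGroup N] [Module R N] (i : ℕ) : Type u :=
  Abelian.Ext.{u} (ModuleCat.of R M) (ModuleCat.of R N) i

variable {R : Type u} [CommRing R] (I : Ideal R)

section System

variable (M N : Type u) [AddCommGroup M] [Module R M] [AddCommGroup N] [Module R N]

/-- The quotient module `M / I^q M`. -/
abbrev quotPow (q : ℕ) : Type u := M ⧸ (I ^ q • ⊤ : Submodule R M)

/-- The natural surjection `M / I^q M → M / I^p M` for `p ≤ q`. -/
def quotPowMap {p q : ℕ} (h : p ≤ q) : quotPow I M q →ₗ[R] quotPow I M p :=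
  Submodule.factor (Submodule.smul_mono_left (Ideal.pow_le_pow_right h))

/-- The map `Ext^i_R(M / I^p M, N) → Ext^i_R(M / I^q M, N)` induced by the natural surjection
`M / I^q M → M / I^p M`, for `p ≤ q`. -/
def extMap (i : ℕ) (p q : ℕ) (h : p ≤ q) :
    ExtModule R (quotPow I M p) N i →ₗ[R] ExtModule R (quotPow I M q) N i :=
  (Abelian.Ext.mk₀ (ModuleCat.ofHom (quotPowMap I M h))).precompOfLinear R
    (ModuleCat.of R N) (zero_add i)

instance directedSystem_extMap (i : ℕ) :
    DirectedSystem (fun q : ℕ => ExtModule R (quotPow I M q) N i)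
      (fun p q h => extMap I M N i p q h) where
  map_self p x := by
    have h : quotPowMap I M (le_refl p) = LinearMap.id := by
      ext x
      rfl
    simp only [extMap, h]
    exact Abelian.Ext.mk₀_id_comp x
  map_map p q r hpq hqr x := by
    have h : ModuleCat.ofHom (quotPowMap I M (hpq.trans hqr)) =
        ModuleCat.ofHom (quotPowMap I M hqr) ≫ ModuleCat.ofHom (quotPowMap I M hpq) := by
      ext x
      rfl
    simp only [extMap, h]
    exact Abelian.Ext.mk₀_comp_mk₀_assoc _ _ x

/-- The generalized local cohomology module `H^i_I(M, N) = colim_q Ext^i_R(M / I^q M, N)`. -/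
abbrev H (i : ℕ) : Type u :=
  Module.DirectLimit (fun q : ℕ => ExtModule R (quotPow I M q) N i) (extMap I M N i)

/-- `depth_I(M, N) = inf {i ≥ 0 | H^i_I(M, N) ≠ 0}`, with `inf ∅ = ∞`. -/
def depthPair : ℕ∞ :=
  ⨅ (i : ℕ) (_ : Nontrivial (H I M N i)), (i : ℕ∞)

/-- `cd_I(M, N) = sup {i ≥ 0 | H^i_I(M, N) ≠ 0}`, with `sup ∅ = -∞` (that is, `⊥`). -/
def cdPair : WithBot ℕ∞ :=
  ⨆ (i : ℕ) (_ : Nontrivial (H I M N i)), ((i : ℕ∞) : WithBot ℕ∞)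

/-- `M, N` is a Cohen-Macaulay pair with respect to `I`: `depth_I(M, N) = cd_I(M, N)`. -/
def IsCohenMacaulayPair : Prop :=
  (depthPair I M N : WithBot ℕ∞) = cdPair I M N

end System

section SingleModule

variable (N : Type u) [AddCommGroup N] [Module R N]

/-- The local cohomology module `H^i_I(N) = colim_q Ext^i_R(R / I^q, N)`. -/
abbrev localH (i : ℕ) : Type u := H I R N i

/-- `depth_I N = inf {i ≥ 0 | H^i_I(N) ≠ 0}`, with `inf ∅ = ∞`. -/
def depth : ℕ∞ :=
  ⨅ (i : ℕ) (_ : Nontrivial (localH I N i)), (i : ℕ∞)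

/-- `cd_I N = sup {i ≥ 0 | H^i_I(N) ≠ 0}`, with `sup ∅ = -∞` (that is, `⊥`). -/
def cd : WithBot ℕ∞ :=
  ⨆ (i : ℕ) (_ : Nontrivial (localH I N i)), ((i : ℕ∞) : WithBot ℕ∞)

/-- `N` is (relative) Cohen-Macaulay with respect to `I`: `depth_I N = cd_I N`. -/
def IsCohenMacaulay : Prop :=
  (depth I N : WithBot ℕ∞) = cd I N

end SingleModule

end GenLocalCohomology

end

namespace GenLocalCohomology

open Abelian

variable {R : Type u} [CommRing R] (I : Ideal R)

/-! The classical route is the spectral sequence `H^p_I(Ext^q(M,N)) ⇒ H^{p+q}_I(M,N)`, which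
collapses when only one row survives. Depth and cohomological dimension depend only on which modules
vanish, so it is enough to show that `H^{i+e}_I(M,N)` and `H^i_I(Ext^e(M,N))` vanish together and
that `H^i_I(M,N) = 0` for `i < e` (`subsingleton_H_pair`). This is done by dimension shifting along
`0 → N → E → Q → 0` with `E` injective.

Two facts replace the spectral sequence. In degree zero, both `H^0_I(M,N)` and `H^0_I(Hom(M,N))` are
the homomorphisms `M → N` killed by a power of `I`. And `Hom(M,E)` is acyclic for local cohomology
(`subsingleton_H_hom_injective`), which rests on Artin–Rees. Shifting then treats `Ext^0`
(`subsingleton_H_iff_hom`) and lowers a positive `e` step by step to `Ext^1`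
(`subsingleton_H_shift_ext`). -/

/-- The short complex of `R`-modules attached to an exact pair of linear maps. -/
noncomputable abbrev sesComplex {A B C : Type u} [AddCommGroup A] [Module R A] [AddCommGroup B] [Module R B]
    [AddCommGroup C] [Module R C] (f : A →ₗ[R] B) (g : B →ₗ[R] C) (h : Function.Exact f g) :
    ShortComplex (ModuleCat.{u} R) :=
  ModuleCat.shortComplexOfCompEqZero f g h.linearMap_comp_eq_zero

lemma sesComplex_shortExact {A B C : Type u} [AddCommGroup A] [Module R A] [AddCommGroup B]
    [Module R B] [AddCommGroup C] [Module R C] {f : A →ₗ[R] B} {g : B →ₗ[R] C}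
    (hf : Function.Injective f) (h : Function.Exact f g) (hg : Function.Surjective g) :
    (sesComplex f g h).ShortExact :=
  ModuleCat.shortComplex_shortExact _ h hf hg

/-- A linear map `φ : A → N` killing `I ^ n A` for some `n`. -/
def IsPowTorsionHom {A N : Type u} [AddCommGroup A] [Module R A] [AddCommGroup N] [Module R N]
    (φ : A →ₗ[R] N) : Prop :=
  ∃ n : ℕ, (I ^ n • ⊤ : Submodule R A) ≤ LinearMap.ker φ

/-- The degree zero extension class of a linear map. -/
noncomputable abbrev extOfHom {A N : Type u} [AddCommGroup A] [Module R A] [AddCommGroup N] [Module R N]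
    (φ : A →ₗ[R] N) : ExtModule R A N 0 :=
  Ext.mk₀ (ModuleCat.ofHom φ)

lemma extOfHom_injective {A N : Type u} [AddCommGroup A] [Module R A] [AddCommGroup N]
    [Module R N] : Function.Injective (extOfHom : (A →ₗ[R] N) → ExtModule R A N 0) := by
  intro φ ψ h
  exact congrArg ModuleCat.Hom.hom ((Ext.mk₀_bijective _ _).1 h)

lemma exists_extOfHom {A N : Type u} [AddCommGroup A] [Module R A] [AddCommGroup N]
    [Module R N] (x : ExtModule R A N 0) : ∃ φ : A →ₗ[R] N, extOfHom φ = x := by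
  obtain ⟨φ, rfl⟩ := (Ext.mk₀_bijective _ _).2 x
  exact ⟨φ.hom, rfl⟩

lemma extOfHom_zero {A N : Type u} [AddCommGroup A] [Module R A] [AddCommGroup N]
    [Module R N] : extOfHom (0 : A →ₗ[R] N) = 0 :=
  Ext.mk₀_zero _ _

lemma extOfHom_comp {A B C : Type u} [AddCommGroup A] [Module R A] [AddCommGroup B]
    [Module R B] [AddCommGroup C] [Module R C] (f : A →ₗ[R] B) (g : B →ₗ[R] C) :
    (extOfHom f).comp (extOfHom g) (add_zero 0) = extOfHom (g ∘ₗ f) :=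
  Ext.mk₀_comp_mk₀ _ _

lemma extMap_comp {A N : Type u} [AddCommGroup A] [Module R A] [AddCommGroup N] [Module R N]
    {N' : Type u} [AddCommGroup N'] [Module R N']
    {i j k p q : ℕ} (h : p ≤ q) (x : ExtModule R (quotPow I A p) N i) (y : ExtModule R N N' j)
    (hk : i + j = k) :
    extMap I A N' k p q h (x.comp y hk) = (extMap I A N i p q h x).comp y hk :=
  (Ext.comp_assoc _ _ _ (zero_add i) hk (by lia)).symm

lemma extMap_extMap {A N : Type u} [AddCommGroup A] [Module R A] [AddCommGroup N] [Module R N]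
    {i p q r : ℕ} (h : p ≤ q) (h' : q ≤ r) (x : ExtModule R (quotPow I A p) N i) :
    extMap I A N i q r h' (extMap I A N i p q h x) = extMap I A N i p r (h.trans h') x :=
  (directedSystem_extMap I A N i).map_map h h' x

/-- `H^i_I(A, N)` vanishes iff every class in the directed system eventually dies. -/
lemma subsingleton_H_iff {A N : Type u} [AddCommGroup A] [Module R A] [AddCommGroup N]
    [Module R N] (i : ℕ) :
    Subsingleton (H I A N i) ↔ ∀ (p : ℕ) (x : ExtModule R (quotPow I A p) N i),
      ∃ (q : ℕ) (h : p ≤ q), extMap I A N i p q h x = 0 := by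
  constructor
  · intro _ p x
    exact Module.DirectLimit.of.zero_exact
      (Subsingleton.elim (Module.DirectLimit.of R ℕ _ (extMap I A N i) p x) 0)
  · intro H
    refine subsingleton_of_forall_eq 0 fun z => ?_
    obtain ⟨p, x, rfl⟩ := Module.DirectLimit.exists_of z
    obtain ⟨q, h, hx⟩ := H p x
    rw [← Module.DirectLimit.of_f (hij := h), hx, map_zero]

/-! ### Vanishing along the long exact sequence in the second variable -/

section LongExact

variable (A : Type u) [AddCommGroup A] [Module R A]
variable {N₁ N₂ N₃ : Type u} [AddCommGroup N₁] [Module R N₁] [AddCommGroup N₂] [Module R N₂]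
  [AddCommGroup N₃] [Module R N₃] {f : N₁ →ₗ[R] N₂} {g : N₂ →ₗ[R] N₃}

/-- This and the next two lemmas chase a single class through the `Ext` sequence of one `A / I^q A`,
enlarging `q` whenever a class has to die; exactness of the colimit itself is never needed. -/
lemma subsingleton_H_middle (hf : Function.Injective f) (hfg : Function.Exact f g)
    (hg : Function.Surjective g) (i : ℕ) (h₁ : Subsingleton (H I A N₁ i))
    (h₃ : Subsingleton (H I A N₃ i)) : Subsingleton (H I A N₂ i) := by
  rw [subsingleton_H_iff] at *
  intro p x
  obtain ⟨q, hq, hx⟩ := h₃ p (x.comp (extOfHom g) (add_zero i))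
  rw [extMap_comp] at hx
  obtain ⟨y, hy⟩ := Ext.covariant_sequence_exact₂ _ (sesComplex_shortExact hf hfg hg) _ hx
  obtain ⟨r, hr, hy'⟩ := h₁ q y
  refine ⟨r, hq.trans hr, ?_⟩
  rw [← extMap_extMap I hq hr, ← hy]
  erw [extMap_comp]
  rw [hy', Ext.zero_comp]

lemma subsingleton_H_right (hf : Function.Injective f) (hfg : Function.Exact f g)
    (hg : Function.Surjective g) (i : ℕ) (h₂ : Subsingleton (H I A N₂ i))
    (h₁ : Subsingleton (H I A N₁ (i + 1))) : Subsingleton (H I A N₃ i) := by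
  rw [subsingleton_H_iff] at *
  intro p x
  have hS := sesComplex_shortExact hf hfg hg
  obtain ⟨q, hq, hx⟩ := h₁ p (x.comp hS.extClass rfl)
  erw [extMap_comp] at hx
  obtain ⟨y, hy⟩ := Ext.covariant_sequence_exact₃ _ hS _ _ hx
  obtain ⟨r, hr, hy'⟩ := h₂ q y
  refine ⟨r, hq.trans hr, ?_⟩
  rw [← extMap_extMap I hq hr, ← hy]
  erw [extMap_comp]
  rw [hy', Ext.zero_comp]

lemma subsingleton_H_left (hf : Function.Injective f) (hfg : Function.Exact f g)
    (hg : Function.Surjective g) (i : ℕ) (h₃ : Subsingleton (H I A N₃ i))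
    (h₂ : Subsingleton (H I A N₂ (i + 1))) : Subsingleton (H I A N₁ (i + 1)) := by
  rw [subsingleton_H_iff] at *
  intro p x
  have hS := sesComplex_shortExact hf hfg hg
  obtain ⟨q, hq, hx⟩ := h₂ p (x.comp (extOfHom f) (add_zero _))
  rw [extMap_comp] at hx
  obtain ⟨y, hy⟩ := Ext.covariant_sequence_exact₁ _ hS _ hx rfl
  obtain ⟨r, hr, hy'⟩ := h₃ q y
  refine ⟨r, hq.trans hr, ?_⟩
  rw [← extMap_extMap I hq hr, ← hy]
  erw [extMap_comp]
  rw [hy', Ext.zero_comp]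

variable {A}

lemma quotPow_hom_ext {N : Type u} [AddCommGroup N] [Module R N] {p : ℕ}
    {φ ψ : quotPow I A p →ₗ[R] N} (h : φ ∘ₗ Submodule.mkQ _ = ψ ∘ₗ Submodule.mkQ _) : φ = ψ :=
  Submodule.linearMap_qext _ h

lemma isPowTorsionHom_comp_mkQ {N : Type u} [AddCommGroup N] [Module R N] {p : ℕ}
    (φ : quotPow I A p →ₗ[R] N) : IsPowTorsionHom I (φ ∘ₗ Submodule.mkQ _) := by
  refine ⟨p, fun x hx => ?_⟩
  simp [(Submodule.Quotient.mk_eq_zero _).2 hx]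

lemma exists_quotPow_factor {N : Type u} [AddCommGroup N] [Module R N] {φ : A →ₗ[R] N}
    (hφ : IsPowTorsionHom I φ) :
    ∃ p, ∃ ψ : quotPow I A p →ₗ[R] N, ψ ∘ₗ Submodule.mkQ _ = φ := by
  obtain ⟨p, hp⟩ := hφ
  exact ⟨p, Submodule.liftQ _ φ hp, Submodule.liftQ_mkQ _ _ hp⟩

lemma extMap_extOfHom {N : Type u} [AddCommGroup N] [Module R N] {p q : ℕ} (h : p ≤ q)
    (φ : quotPow I A p →ₗ[R] N) :
    extMap I A N 0 p q h (extOfHom φ) = extOfHom (φ ∘ₗ quotPowMap I A h) :=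
  Ext.mk₀_comp_mk₀ _ _

/-- Each `Hom(A / I^p A, N)` embeds in `Hom(A, N)`, so the colimit in degree zero is the union of
these subgroups. -/
lemma subsingleton_H_zero_iff {N : Type u} [AddCommGroup N] [Module R N] :
    Subsingleton (H I A N 0) ↔ ∀ φ : A →ₗ[R] N, IsPowTorsionHom I φ → φ = 0 := by
  rw [subsingleton_H_iff]
  constructor
  · intro H φ hφ
    obtain ⟨p, ψ, rfl⟩ := exists_quotPow_factor I hφ
    obtain ⟨q, h, hq⟩ := H p (extOfHom ψ)
    rw [extMap_extOfHom, ← extOfHom_zero] at hq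
    have := extOfHom_injective hq
    ext x
    exact LinearMap.congr_fun this (Submodule.Quotient.mk x)
  · intro H p x
    obtain ⟨φ, rfl⟩ := exists_extOfHom x
    refine ⟨p, le_rfl, ?_⟩
    have : φ = 0 := quotPow_hom_ext I (by
      rw [H _ (isPowTorsionHom_comp_mkQ I φ), LinearMap.zero_comp])
    rw [this, extOfHom_zero, map_zero]

/-- If `H^1_I(A, N₁) = 0`, then power torsion homomorphisms lift along `g`. -/
lemma exists_isPowTorsionHom_lift (hf : Function.Injective f) (hfg : Function.Exact f g)
    (hg : Function.Surjective g) (h₁ : Subsingleton (H I A N₁ 1)) (φ : A →ₗ[R] N₃)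
    (hφ : IsPowTorsionHom I φ) : ∃ ψ : A →ₗ[R] N₂, IsPowTorsionHom I ψ ∧ g ∘ₗ ψ = φ := by
  rw [subsingleton_H_iff] at h₁
  have hS := sesComplex_shortExact hf hfg hg
  obtain ⟨p, φ, rfl⟩ := exists_quotPow_factor I hφ
  obtain ⟨q, hq, hx⟩ := h₁ p ((extOfHom φ).comp hS.extClass (zero_add 1))
  erw [extMap_comp] at hx
  obtain ⟨y, hy⟩ := Ext.covariant_sequence_exact₃ _ hS _ _ hx
  obtain ⟨ψ, rfl⟩ := exists_extOfHom y
  refine ⟨ψ ∘ₗ Submodule.mkQ _, isPowTorsionHom_comp_mkQ I ψ, ?_⟩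
  erw [extOfHom_comp, extMap_extOfHom] at hy
  have := extOfHom_injective hy
  ext x
  exact LinearMap.congr_fun this (Submodule.Quotient.mk x)

/-- Since `H^1_I(A, N₂) = 0`, every class in `H^1_I(A, N₁)` comes from a torsion homomorphism `A →
N₃` under the connecting map, and that map kills whatever lifts to `N₂`. -/
lemma subsingleton_H_one_of_lift (hf : Function.Injective f) (hfg : Function.Exact f g)
    (hg : Function.Surjective g) (h₂ : Subsingleton (H I A N₂ 1))
    (hlift : ∀ φ : A →ₗ[R] N₃, IsPowTorsionHom I φ →
      ∃ ψ : A →ₗ[R] N₂, IsPowTorsionHom I ψ ∧ g ∘ₗ ψ = φ) : Subsingleton (H I A N₁ 1) := by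
  rw [subsingleton_H_iff] at *
  intro p x
  have hS := sesComplex_shortExact hf hfg hg
  obtain ⟨q, hq, hx⟩ := h₂ p (x.comp (extOfHom f) (add_zero _))
  rw [extMap_comp] at hx
  obtain ⟨y, hy⟩ := Ext.covariant_sequence_exact₁ _ hS _ hx rfl
  obtain ⟨φ, rfl⟩ := exists_extOfHom y
  obtain ⟨ψ, hψ, hgψ⟩ := hlift _ (isPowTorsionHom_comp_mkQ I φ)
  obtain ⟨m, ψ, rfl⟩ := exists_quotPow_factor I hψ
  -- Stage `q` brings the class into the image of the connecting map; the lift of `φ` only exists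
  -- from stage `m` on.
  refine ⟨max q m, hq.trans (le_max_left _ _), ?_⟩
  rw [← extMap_extMap I hq (le_max_left _ _), ← hy]
  erw [extMap_comp, extMap_extOfHom]
  have : φ ∘ₗ quotPowMap I A (le_max_left q m) = g ∘ₗ ψ ∘ₗ quotPowMap I A (le_max_right q m) := by
    apply quotPow_hom_ext I
    ext x
    exact (LinearMap.congr_fun hgψ x).symm
  rw [this, ← extOfHom_comp]
  erw [Ext.comp_assoc _ (Ext.mk₀ (sesComplex f g hfg).g) hS.extClass (add_zero 0) (zero_add 1) rfl]
  rw [ShortComplex.ShortExact.comp_extClass, Ext.comp_zero]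

end LongExact
-- Injective coefficients and invariance under isomorphism
section Vanishing

variable (A : Type u) [AddCommGroup A] [Module R A]

lemma subsingleton_H_of_subsingleton_ext {N : Type u} [AddCommGroup N] [Module R N] (i : ℕ)
    (h : ∀ p, Subsingleton (ExtModule R (quotPow I A p) N i)) : Subsingleton (H I A N i) := by
  rw [subsingleton_H_iff]
  exact fun p x => ⟨p, le_rfl, Subsingleton.elim _ _⟩

lemma subsingleton_H_injective {E : Type u} [AddCommGroup E] [Module R E] [Module.Injective R E]
    (i : ℕ) : Subsingleton (H I A E (i + 1)) := by
  have : Injective (ModuleCat.of R E) := Module.injective_object_of_injective_module R E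
  exact subsingleton_H_of_subsingleton_ext I A _ fun p => Ext.subsingleton_of_injective _ _ i

lemma subsingleton_H_of_equiv {N N' : Type u} [AddCommGroup N] [Module R N] [AddCommGroup N']
    [Module R N'] (e : N ≃ₗ[R] N') (i : ℕ) (h : Subsingleton (H I A N i)) :
    Subsingleton (H I A N' i) := by
  rw [subsingleton_H_iff] at *
  intro p x
  obtain ⟨q, hq, hx⟩ := h p (x.comp (extOfHom e.symm.toLinearMap) (add_zero i))
  refine ⟨q, hq, ?_⟩
  have hx' : x = (x.comp (extOfHom e.symm.toLinearMap) (add_zero i)).comp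
      (extOfHom e.toLinearMap) (add_zero i) := by
    rw [Ext.comp_assoc _ _ _ (add_zero i) (add_zero 0) (by lia), extOfHom_comp,
      LinearEquiv.comp_symm]
    exact (Ext.comp_mk₀_id x).symm
  rw [hx', extMap_comp, hx, Ext.zero_comp]

lemma subsingleton_H_congr {N N' : Type u} [AddCommGroup N] [Module R N] [AddCommGroup N']
    [Module R N'] (e : N ≃ₗ[R] N') (i : ℕ) :
    Subsingleton (H I A N i) ↔ Subsingleton (H I A N' i) :=
  ⟨subsingleton_H_of_equiv I A e i, subsingleton_H_of_equiv I A e.symm i⟩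

end Vanishing

/-! ### Torsion homomorphisms, Artin–Rees and acyclicity of `Hom(M, E)` -/

lemma isPowTorsionHom_ring_iff {N : Type u} [AddCommGroup N] [Module R N] (φ : R →ₗ[R] N) :
    IsPowTorsionHom I φ ↔ ∃ n, ∀ a ∈ I ^ n, a • φ 1 = 0 := by
  have (n : ℕ) : (I ^ n • ⊤ : Submodule R R) = I ^ n := by simp
  simp only [IsPowTorsionHom, this, SetLike.le_def, LinearMap.mem_ker]
  simp only [← map_smul, smul_eq_mul, mul_one]

lemma isPowTorsionHom_iff {M N : Type u} [AddCommGroup M] [Module R M] [AddCommGroup N]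
    [Module R N] (φ : M →ₗ[R] N) :
    IsPowTorsionHom I φ ↔ ∃ n, ∀ a ∈ I ^ n, a • φ = 0 := by
  simp only [IsPowTorsionHom, Submodule.smul_le, LinearMap.mem_ker, LinearMap.ext_iff]
  simp

lemma isPowTorsionHom_hom_iff {M N : Type u} [AddCommGroup M] [Module R M] [AddCommGroup N]
    [Module R N] (φ : R →ₗ[R] (M →ₗ[R] N)) :
    IsPowTorsionHom I φ ↔ IsPowTorsionHom I (φ 1) := by
  rw [isPowTorsionHom_ring_iff, isPowTorsionHom_iff]

/-- **Artin–Rees**: a homomorphism from a submodule `K` of a finite module `F` to an injective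
module that kills `I ^ n K` extends to a homomorphism on `F` killing some `I ^ m F`. -/
lemma exists_isPowTorsionHom_extension [IsNoetherianRing R] {F E : Type u} [AddCommGroup F]
    [Module R F] [Module.Finite R F] [AddCommGroup E] [Module R E] [Module.Injective R E]
    (K : Submodule R F) (φ : K →ₗ[R] E) (hφ : IsPowTorsionHom I φ) :
    ∃ ψ : F →ₗ[R] E, IsPowTorsionHom I ψ ∧ ψ ∘ₗ K.subtype = φ := by
  obtain ⟨n, hn⟩ := hφ
  obtain ⟨k, hk⟩ := I.exists_pow_inf_eq_pow_smul K
  -- By Artin–Rees, `ker u = K ∩ I^(n+k) F` lies in `I^n K`, so `φ` descends to `K / ker u`. This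
  -- embeds in `F / I^(n+k) F`, where injectivity of `E` gives the extension.
  let u := (I ^ (n + k) • ⊤ : Submodule R F).mkQ ∘ₗ K.subtype
  have hu : LinearMap.ker u ≤ LinearMap.ker φ := by
    intro x hx
    have hx' : (x : F) ∈ (I ^ (n + k) • ⊤ : Submodule R F) ⊓ K :=
      ⟨(Submodule.Quotient.mk_eq_zero _).1 (by simpa [u] using hx), x.2⟩
    rw [hk (n + k) (by lia), Nat.add_sub_cancel] at hx'
    have hx'' : (x : F) ∈ (I ^ n • ⊤ : Submodule R K).map K.subtype := by
      rw [Submodule.map_smul'', Submodule.map_subtype_top]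
      exact Submodule.smul_mono le_rfl inf_le_right hx'
    obtain ⟨y, hy, hyx⟩ := hx''
    exact hn (Subtype.ext hyx ▸ hy)
  obtain ⟨h, hh⟩ := Module.Injective.extension_property R E _ _
    ((LinearMap.ker u).liftQ u le_rfl)
    (LinearMap.ker_eq_bot.1 (Submodule.ker_liftQ_eq_bot _ _ _ le_rfl))
    ((LinearMap.ker u).liftQ φ hu)
  refine ⟨h ∘ₗ Submodule.mkQ _, isPowTorsionHom_comp_mkQ I h, ?_⟩
  ext x
  exact LinearMap.congr_fun hh (Submodule.Quotient.mk x)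

/-- A presentation `0 → K → R^n → M → 0` gives `0 → Hom(M,E) → E^n → Hom(K,E) → 0` with `E^n`
injective. In degree 1, Artin–Rees lifts torsion maps `K → E` to torsion maps `R^n → E`; higher
degrees shift to `K`, which is again finite. -/
lemma subsingleton_H_hom_injective [IsNoetherianRing R] {E : Type u} [AddCommGroup E] [Module R E]
    [Module.Injective R E] (i : ℕ) : ∀ (M : Type u) [AddCommGroup M] [Module R M]
    [Module.Finite R M], Subsingleton (H I R (M →ₗ[R] E) (i + 1)) := by
  induction i with
  | zero =>
    intro M _ _ _
    obtain ⟨n, π, hπ⟩ := Module.Finite.exists_fin' R M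
    refine subsingleton_H_one_of_lift I (f := LinearMap.lcomp R E π)
      (g := LinearMap.lcomp R E (LinearMap.ker π).subtype)
      (LinearMap.lcomp_injective_of_surjective _ hπ)
      (LinearMap.exact_lcomp_of_exact_of_surjective _ (LinearMap.exact_subtype_ker_map π) hπ)
      (fun φ => Module.Injective.extension_property R E _ _ _ (Submodule.subtype_injective _) φ)
      (subsingleton_H_of_equiv I R (LinearEquiv.piRing R E (Fin n) R).symm 1
        (subsingleton_H_injective I R 0)) fun φ hφ => ?_
    obtain ⟨ψ, hψ, hψφ⟩ := exists_isPowTorsionHom_extension I (LinearMap.ker π) (φ 1)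
      ((isPowTorsionHom_hom_iff I φ).1 hφ)
    refine ⟨LinearMap.toSpanSingleton R _ ψ, (isPowTorsionHom_hom_iff I _).2 (by simpa using hψ),
      LinearMap.ext_ring ?_⟩
    simpa [LinearMap.lcomp_apply'] using hψφ
  | succ i ih =>
    intro M _ _ _
    obtain ⟨n, π, hπ⟩ := Module.Finite.exists_fin' R M
    exact subsingleton_H_left I R (f := LinearMap.lcomp R E π)
      (g := LinearMap.lcomp R E (LinearMap.ker π).subtype)
      (LinearMap.lcomp_injective_of_surjective _ hπ)
      (LinearMap.exact_lcomp_of_exact_of_surjective _ (LinearMap.exact_subtype_ker_map π) hπ)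
      (fun φ => Module.Injective.extension_property R E _ _ _ (Submodule.subtype_injective _) φ)
      (i + 1) (ih _) (subsingleton_H_of_equiv I R (LinearEquiv.piRing R E (Fin n) R).symm _
        (subsingleton_H_injective I R _))
lemma exists_injective_embedding (N : Type u) [AddCommGroup N] [Module R N] :
    ∃ (E : Type u) (_ : AddCommGroup E) (_ : Module R E) (_ : Module.Injective R E)
      (f : N →ₗ[R] E), Function.Injective f :=
  ⟨(Injective.under (ModuleCat.of R N) : ModuleCat.{u} R), inferInstance, inferInstance,
    Module.injective_module_of_injective_object R _ (inj := Injective.injective_under _),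
    (Injective.ι (ModuleCat.of R N)).hom, (ModuleCat.mono_iff_injective _).1 inferInstance⟩

/-- Postcomposition with `f`, as a linear map between modules of homomorphisms. -/
abbrev homPost (M : Type u) [AddCommGroup M] [Module R M] {N₁ N₂ : Type u}
    [AddCommGroup N₁] [Module R N₁] [AddCommGroup N₂] [Module R N₂] (f : N₁ →ₗ[R] N₂) :
    (M →ₗ[R] N₁) →ₗ[R] (M →ₗ[R] N₂) where
  toFun φ := f ∘ₗ φ
  map_add' φ ψ := LinearMap.comp_add φ ψ f
  map_smul' a φ := LinearMap.comp_smul f a φ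

lemma homPost_injective (M : Type u) [AddCommGroup M] [Module R M] {N₁ N₂ : Type u}
    [AddCommGroup N₁] [Module R N₁] [AddCommGroup N₂] [Module R N₂] {f : N₁ →ₗ[R] N₂}
    (hf : Function.Injective f) : Function.Injective (homPost M f) :=
  fun _ _ h => LinearMap.ext fun x => hf (LinearMap.congr_fun h x)

lemma homPost_exact (M : Type u) [AddCommGroup M] [Module R M] {N₁ N₂ N₃ : Type u}
    [AddCommGroup N₁] [Module R N₁] [AddCommGroup N₂] [Module R N₂] [AddCommGroup N₃] [Module R N₃]
    {f : N₁ →ₗ[R] N₂} {g : N₂ →ₗ[R] N₃} (hf : Function.Injective f) (hfg : Function.Exact f g) :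
    Function.Exact (homPost M f) (homPost M g) := by
  intro φ
  constructor
  · intro h
    have h' (x : M) : φ x ∈ LinearMap.range f := (hfg (φ x)).1 (LinearMap.congr_fun h x)
    refine ⟨(LinearEquiv.ofInjective f hf).symm.toLinearMap ∘ₗ φ.codRestrict _ h', ?_⟩
    ext x
    exact congrArg Subtype.val
      ((LinearEquiv.ofInjective f hf).apply_symm_apply (φ.codRestrict _ h' x))
  · rintro ⟨ψ, rfl⟩
    ext x
    exact hfg.apply_apply_eq_zero (ψ x)

/-- `Hom(M, N₂) → Hom(M, N₃)` need not be onto, so the degree-one lifting criterion is applied to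
its corestriction to the range. -/
lemma exists_isPowTorsionHom_hom_lift {M N₁ N₂ N₃ : Type u} [AddCommGroup M] [Module R M]
    [AddCommGroup N₁] [Module R N₁] [AddCommGroup N₂] [Module R N₂] [AddCommGroup N₃] [Module R N₃]
    {f : N₁ →ₗ[R] N₂} {g : N₂ →ₗ[R] N₃} (hf : Function.Injective f) (hfg : Function.Exact f g)
    (h₁ : Subsingleton (H I R (M →ₗ[R] N₁) 1)) (φ : M →ₗ[R] N₃) (hφ : IsPowTorsionHom I φ)
    (hr : φ ∈ LinearMap.range (homPost M g)) :
    ∃ ψ : M →ₗ[R] N₂, IsPowTorsionHom I ψ ∧ g ∘ₗ ψ = φ := by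
  let G := homPost M g
  obtain ⟨n, hn⟩ := (isPowTorsionHom_iff I φ).1 hφ
  obtain ⟨ψ, hψ, hψφ⟩ := exists_isPowTorsionHom_lift I (A := R) (g := G.rangeRestrict)
    (homPost_injective M hf)
    (fun χ => by
      rw [← homPost_exact M hf hfg χ, ← Subtype.coe_inj]; rfl)
    G.surjective_rangeRestrict h₁ (LinearMap.toSpanSingleton R _ ⟨φ, hr⟩)
    ((isPowTorsionHom_ring_iff I _).2 ⟨n, fun a ha => by
      ext1
      simpa using hn a ha⟩)
  refine ⟨ψ 1, (isPowTorsionHom_hom_iff I ψ).1 hψ, ?_⟩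
  simpa [G] using congrArg Subtype.val (LinearMap.congr_fun hψφ 1)

/-! ### Dimension shifting along an injective embedding -/

section Shift

variable {N E Q : Type u} [AddCommGroup N] [Module R N] [AddCommGroup E] [Module R E]
  [Module.Injective R E] [AddCommGroup Q] [Module R Q] {f : N →ₗ[R] E} {g : E →ₗ[R] Q}

lemma subsingleton_H_shift (A : Type u) [AddCommGroup A] [Module R A]
    (hf : Function.Injective f) (hfg : Function.Exact f g)
    (hg : Function.Surjective g) (i : ℕ) :
    Subsingleton (H I A N (i + 2)) ↔ Subsingleton (H I A Q (i + 1)) :=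
  ⟨subsingleton_H_right I A hf hfg hg (i + 1) (subsingleton_H_injective I A i),
    fun h => subsingleton_H_left I A hf hfg hg (i + 1) h (subsingleton_H_injective I A _)⟩

lemma ext_injective_eq_zero {A : Type u} [AddCommGroup A] [Module R A] {i : ℕ}
    (x : ExtModule R A E (i + 1)) : x = 0 := by
  have : Injective (ModuleCat.of R E) := Module.injective_object_of_injective_module R E
  exact Ext.eq_zero_of_injective x

lemma nonempty_ext_equiv_shift (A : Type u) [AddCommGroup A] [Module R A]
    (hf : Function.Injective f) (hfg : Function.Exact f g)
    (hg : Function.Surjective g) (i : ℕ) :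
    Nonempty (ExtModule R A Q (i + 1) ≃ₗ[R] ExtModule R A N (i + 2)) := by
  have hS := sesComplex_shortExact hf hfg hg
  let δ : ExtModule R A Q (i + 1) →ₗ[R] ExtModule R A N (i + 2) :=
    hS.extClass.postcompOfLinear R (ModuleCat.of R A) rfl
  refine ⟨LinearEquiv.ofBijective δ ⟨?_, fun x => ?_⟩⟩
  · rw [injective_iff_map_eq_zero]
    intro x hx
    obtain ⟨y, rfl⟩ := Ext.covariant_sequence_exact₃ _ hS _ rfl hx
    rw [ext_injective_eq_zero y]
    rw [Ext.zero_comp]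
  · exact Ext.covariant_sequence_exact₁ _ hS x (ext_injective_eq_zero _) rfl

lemma exists_hom_to_ext_one (A : Type u) [AddCommGroup A] [Module R A]
    (hf : Function.Injective f) (hfg : Function.Exact f g)
    (hg : Function.Surjective g) :
    ∃ δ : (A →ₗ[R] Q) →ₗ[R] ExtModule R A N 1,
      Function.Exact (homPost A g) δ ∧ Function.Surjective δ := by
  have hS := sesComplex_shortExact hf hfg hg
  let δ : (A →ₗ[R] Q) →ₗ[R] ExtModule R A N 1 :=
    (hS.extClass.postcompOfLinear R (ModuleCat.of R A) (zero_add 1)) ∘ₗ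
      (Ext.linearEquiv₀.trans ModuleCat.homLinearEquiv).symm.toLinearMap
  have hδ (φ : A →ₗ[R] Q) : δ φ = (extOfHom φ).comp hS.extClass (zero_add 1) := rfl
  refine ⟨δ, fun φ => ?_, fun x => ?_⟩
  · rw [hδ]
    constructor
    · intro h
      obtain ⟨y, hy⟩ := Ext.covariant_sequence_exact₃ _ hS _ _ h
      obtain ⟨ψ, rfl⟩ := exists_extOfHom y
      exact ⟨ψ, extOfHom_injective ((extOfHom_comp ψ g).symm.trans hy)⟩
    · rintro ⟨ψ, rfl⟩
      have : homPost A g ψ = g ∘ₗ ψ := rfl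
      rw [this, ← extOfHom_comp]
      erw [Ext.comp_assoc _ (Ext.mk₀ (sesComplex f g hfg).g) hS.extClass (add_zero 0)
        (zero_add 1) rfl]
      rw [ShortComplex.ShortExact.comp_extClass, Ext.comp_zero]
  · obtain ⟨y, hy⟩ := Ext.covariant_sequence_exact₁ _ hS x (ext_injective_eq_zero _) rfl
    obtain ⟨φ, rfl⟩ := exists_extOfHom y
    exact ⟨φ, hy⟩

end Shift

/-! ### Comparing the pair with its only nonzero `Ext` -/

section Comparison

variable [IsNoetherianRing R] (M : Type u) [AddCommGroup M] [Module R M] [Module.Finite R M]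

/-- If `Ext^j_R(M, N) = 0` for `j > 0`, then `H^i_I(M, N)` and `H^i_I(Hom(M, N))` vanish
simultaneously. -/
lemma subsingleton_H_iff_hom (i : ℕ) : ∀ (N : Type u) [AddCommGroup N] [Module R N],
    (∀ j, Subsingleton (ExtModule R M N (j + 1))) →
    (Subsingleton (H I M N i) ↔ Subsingleton (H I R (M →ₗ[R] N) i)) := by
  match i with
  | 0 =>
    intro N _ _ _
    rw [subsingleton_H_zero_iff, subsingleton_H_zero_iff]
    refine ⟨fun h φ hφ => LinearMap.ext_ring (h _ ((isPowTorsionHom_hom_iff I φ).1 hφ)),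
      fun h φ hφ => ?_⟩
    have := h (LinearMap.toSpanSingleton R _ φ) ((isPowTorsionHom_hom_iff I _).2 (by simpa using hφ))
    simpa using LinearMap.congr_fun this 1
  | i + 1 =>
    intro N _ _ hN
    obtain ⟨E, _, _, _, f, hf⟩ := exists_injective_embedding (R := R) N
    have hfg : Function.Exact f (LinearMap.range f).mkQ := f.exact_map_mkQ_range
    have hg := (LinearMap.range f).mkQ_surjective
    obtain ⟨δ, hδ, -⟩ := exists_hom_to_ext_one M hf hfg hg
    have := hN 0
    have hs : Function.Surjective (homPost M (LinearMap.range f).mkQ) :=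
      fun φ => (hδ φ).1 (Subsingleton.elim _ _)
    -- Degree 1 is separate: it would shift to degree 0, where `E` is not acyclic, so torsion lifts
    -- replace the shift.
    match i with
    | 0 =>
      constructor
      · intro h
        refine subsingleton_H_one_of_lift I (homPost_injective M hf) (homPost_exact M hf hfg) hs
          (subsingleton_H_hom_injective I 0 M) fun φ hφ => ?_
        obtain ⟨ψ, hψ, hψφ⟩ := exists_isPowTorsionHom_lift I hf hfg hg h (φ 1)
          ((isPowTorsionHom_hom_iff I φ).1 hφ)
        refine ⟨LinearMap.toSpanSingleton R _ ψ, (isPowTorsionHom_hom_iff I _).2 (by simpa using hψ),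
          LinearMap.ext_ring ?_⟩
        simpa using hψφ
      · intro h
        exact subsingleton_H_one_of_lift I hf hfg hg (subsingleton_H_injective I M 0)
          fun φ hφ => exists_isPowTorsionHom_hom_lift I hf hfg h φ hφ (hs φ)
    | i + 1 =>
      rw [subsingleton_H_shift I M hf hfg hg, subsingleton_H_iff_hom (i + 1) _ fun j => ?_]
      · exact ⟨fun h => subsingleton_H_left I R (homPost_injective M hf) (homPost_exact M hf hfg) hs
            (i + 1) h (subsingleton_H_hom_injective I _ M),
          subsingleton_H_right I R (homPost_injective M hf) (homPost_exact M hf hfg) hs (i + 1)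
            (subsingleton_H_hom_injective I _ M)⟩
      · obtain ⟨e⟩ := nonempty_ext_equiv_shift M hf hfg hg j
        have := hN (j + 1)
        exact e.toEquiv.subsingleton

/-- The degree shift between the pair `M, N` and `Ext^{e+1}_R(M, N)`, when this is the only
nonzero positive `Ext` and `Hom(M, N)` has no higher local cohomology. -/
lemma subsingleton_H_shift_ext (e : ℕ) : ∀ (N : Type u) [AddCommGroup N] [Module R N],
    (∀ j, j ≠ e → Subsingleton (ExtModule R M N (j + 1))) →
    (∀ j, Subsingleton (H I R (M →ₗ[R] N) (j + 1))) →
    (∀ i < e, Subsingleton (H I M N (i + 1))) ∧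
      ∀ i, Subsingleton (H I M N (i + (e + 1))) ↔
        Subsingleton (H I R (ExtModule R M N (e + 1)) i) := by
  induction e with
  | zero =>
    intro N _ _ hN hH
    refine ⟨fun i hi => absurd hi (Nat.not_lt_zero i), fun i => ?_⟩
    obtain ⟨E, _, _, _, f, hf⟩ := exists_injective_embedding (R := R) N
    have hfg : Function.Exact f (LinearMap.range f).mkQ := f.exact_map_mkQ_range
    have hg := (LinearMap.range f).mkQ_surjective
    obtain ⟨δ, hδ, hδs⟩ := exists_hom_to_ext_one M hf hfg hg
    let G := homPost M (LinearMap.range f).mkQ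
    -- The image `B` of `Hom(M,E)` in `Hom(M,Q)` is a quotient of an acyclic module by an acyclic
    -- one. Hence `0 → B → Hom(M,Q) → Ext^1(M,N) → 0` passes vanishing in positive degrees between
    -- the last two terms.
    have hB (j : ℕ) : Subsingleton (H I R (LinearMap.range G) (j + 1)) :=
      subsingleton_H_right I R (g := G.rangeRestrict) (homPost_injective M hf)
        (fun χ => by rw [← homPost_exact M hf hfg χ, ← Subtype.coe_inj]; rfl)
        G.surjective_rangeRestrict _ (subsingleton_H_hom_injective I j M) (hH (j + 1))
    have hδ' : Function.Exact (LinearMap.range G).subtype δ := fun φ => by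
      rw [hδ φ]; simp [G]
    match i with
    | 0 =>
      constructor
      · intro h
        rw [subsingleton_H_zero_iff]
        intro φ hφ
        -- A torsion element of `Ext^1(M,N)` lifts to a torsion map `M → Q` because `H^1_I(B) = 0`,
        -- then to `M → E` by hypothesis, so its image under `δ` is zero.
        obtain ⟨ψ, hψ, rfl⟩ := exists_isPowTorsionHom_lift I (Submodule.subtype_injective _) hδ' hδs
          (hB 0) φ hφ
        obtain ⟨χ, -, hχ⟩ := exists_isPowTorsionHom_lift I hf hfg hg h (ψ 1)
          ((isPowTorsionHom_hom_iff I ψ).1 hψ)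
        exact LinearMap.ext_ring ((hδ _).2 ⟨χ, hχ⟩)
      · intro h
        rw [subsingleton_H_zero_iff] at h
        refine subsingleton_H_one_of_lift I hf hfg hg (subsingleton_H_injective I M 0)
          fun φ hφ => exists_isPowTorsionHom_hom_lift I hf hfg (hH 0) φ hφ ((hδ φ).1 ?_)
        obtain ⟨n, hn⟩ := (isPowTorsionHom_iff I φ).1 hφ
        have := h (LinearMap.toSpanSingleton R _ (δ φ)) ((isPowTorsionHom_ring_iff I _).2
          ⟨n, fun a ha => by rw [LinearMap.toSpanSingleton_apply, one_smul, ← map_smul, hn a ha,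
            map_zero]⟩)
        simpa using LinearMap.congr_fun this 1
    | i + 1 =>
      rw [subsingleton_H_shift I M hf hfg hg, subsingleton_H_iff_hom I M (i + 1) _ fun j => ?_]
      · exact ⟨fun h => subsingleton_H_right I R (Submodule.subtype_injective _) hδ' hδs _ h
            (hB (i + 1)),
          subsingleton_H_middle I R (Submodule.subtype_injective _) hδ' hδs _ (hB i)⟩
      · obtain ⟨e⟩ := nonempty_ext_equiv_shift M hf hfg hg j
        have := hN (j + 1) (by lia)
        exact e.toEquiv.subsingleton
  | succ e ih =>
    intro N _ _ hN hH
    obtain ⟨E, _, _, _, f, hf⟩ := exists_injective_embedding (R := R) N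
    have hfg : Function.Exact f (LinearMap.range f).mkQ := f.exact_map_mkQ_range
    have hg := (LinearMap.range f).mkQ_surjective
    obtain ⟨δ, hδ, -⟩ := exists_hom_to_ext_one M hf hfg hg
    have := hN 0 (by lia)
    have hs : Function.Surjective (homPost M (LinearMap.range f).mkQ) :=
      fun φ => (hδ φ).1 (Subsingleton.elim _ _)
    -- Even if `Hom(M,N) = 0`, `Hom(M,Q)` need not be zero, but it stays acyclic; hence the
    -- induction carries acyclicity of `Hom` and not its vanishing.
    obtain ⟨ih₁, ih₂⟩ := ih (E ⧸ LinearMap.range f)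
      (fun j hj => by
        obtain ⟨e⟩ := nonempty_ext_equiv_shift M hf hfg hg j
        have := hN (j + 1) (by lia)
        exact e.toEquiv.subsingleton)
      (fun j => subsingleton_H_right I R (homPost_injective M hf) (homPost_exact M hf hfg) hs _
        (subsingleton_H_hom_injective I j M) (hH (j + 1)))
    refine ⟨fun i hi => ?_, fun i => ?_⟩
    · match i with
      | 0 =>
        exact subsingleton_H_one_of_lift I hf hfg hg (subsingleton_H_injective I M 0)
          fun φ hφ => exists_isPowTorsionHom_hom_lift I hf hfg (hH 0) φ hφ (hs φ)
      | i + 1 => exact (subsingleton_H_shift I M hf hfg hg i).2 (ih₁ i (by lia))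
    · obtain ⟨ε⟩ := nonempty_ext_equiv_shift M hf hfg hg e
      rw [← subsingleton_H_congr I R ε i, ← ih₂ i]
      exact subsingleton_H_shift I M hf hfg hg (i + e)

lemma subsingleton_H_pair (N : Type u) [AddCommGroup N] [Module R N] (e : ℕ)
    (hExt : ∀ i, i ≠ e → Subsingleton (ExtModule R M N i)) :
    (∀ i < e, Subsingleton (H I M N i)) ∧
      ∀ i, Subsingleton (H I M N (i + e)) ↔ Subsingleton (H I R (ExtModule R M N e) i) := by
  have ε : ExtModule R M N 0 ≃ₗ[R] (M →ₗ[R] N) := Ext.linearEquiv₀.trans ModuleCat.homLinearEquiv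
  match e with
  | 0 =>
    refine ⟨fun i hi => absurd hi (Nat.not_lt_zero i), fun i => ?_⟩
    rw [subsingleton_H_congr I R ε i]
    exact subsingleton_H_iff_hom I M i N fun j => hExt _ (by lia)
  | e + 1 =>
    have h₀ : Subsingleton (M →ₗ[R] N) :=
      have := hExt 0 (by lia)
      ε.symm.toEquiv.subsingleton
    obtain ⟨h₁, h₂⟩ := subsingleton_H_shift_ext I M e N (fun j hj => hExt _ (by lia)) fun j => by
      -- The zero module is injective, hence acyclic.
      have : Module.Injective R (M →ₗ[R] N) := ⟨fun _ _ _ _ _ _ _ _ _ =>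
        ⟨0, fun _ => Subsingleton.elim _ _⟩⟩
      exact subsingleton_H_injective I R j
    refine ⟨fun i hi => ?_, h₂⟩
    match i with
    | 0 => exact (subsingleton_H_zero_iff I).2 fun φ _ => Subsingleton.elim _ _
    | i + 1 => exact h₁ i (by lia)

end Comparison

end GenLocalCohomology

/-! ### Shifting infima and suprema in `ℕ∞` and `WithBot ℕ∞` -/

lemma add_coe_natCast_cancel {a b : WithBot ℕ∞} (e : ℕ)
    (h : a + ((e : ℕ∞) : WithBot ℕ∞) = b + ((e : ℕ∞) : WithBot ℕ∞)) : a = b := by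
  induction a with
  | bot =>
    induction b with
    | bot => rfl
    | coe b => exact absurd h.symm WithBot.coe_ne_bot
  | coe a =>
    induction b with
    | bot => exact absurd h WithBot.coe_ne_bot
    | coe b =>
      rw [← WithBot.coe_add, ← WithBot.coe_add, WithBot.coe_inj] at h
      rw [WithBot.coe_inj]
      exact ENat.add_left_injective_of_ne_top (ENat.natCast_ne_top e) h

lemma iInf_shift (P Q : ℕ → Prop) (e : ℕ) (h₁ : ∀ i < e, ¬ P i) (h₂ : ∀ i, P (i + e) ↔ Q i) :
    (⨅ (i : ℕ) (_ : P i), (i : ℕ∞)) = (⨅ (i : ℕ) (_ : Q i), (i : ℕ∞)) + e := by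
  rw [ENat.iInf_add]
  apply le_antisymm
  · refine le_iInf fun i => ?_
    by_cases hi : Q i
    · simp only [hi, iInf_pos]
      exact (iInf₂_le (i + e) ((h₂ i).2 hi)).trans (by simp)
    · simp [hi]
  · refine le_iInf₂ fun i hi => ?_
    obtain ⟨j, rfl⟩ := Nat.exists_eq_add_of_le' (not_lt.1 fun h => h₁ i h hi)
    refine (iInf_le _ j).trans ?_
    simp [(h₂ j).1 hi]

lemma iSup_shift (P Q : ℕ → Prop) (e : ℕ) (h₁ : ∀ i < e, ¬ P i) (h₂ : ∀ i, P (i + e) ↔ Q i) :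
    (⨆ (i : ℕ) (_ : P i), ((i : ℕ∞) : WithBot ℕ∞)) =
      (⨆ (i : ℕ) (_ : Q i), ((i : ℕ∞) : WithBot ℕ∞)) + ((e : ℕ∞) : WithBot ℕ∞) := by
  -- If `Q` never holds, both suprema are `⊥`, which absorbs `e`. Otherwise the left side is not `⊥`
  -- and is at least `e`, so truncated subtraction of `e` loses nothing.
  by_cases hQ : ∃ i, Q i
  · obtain ⟨i₀, hi₀⟩ := hQ
    apply le_antisymm
    · refine iSup₂_le fun i hi => ?_
      obtain ⟨j, rfl⟩ := Nat.exists_eq_add_of_le' (not_lt.1 fun h => h₁ i h hi)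
      rw [Nat.cast_add, WithBot.coe_add]
      gcongr
      exact le_iSup₂_of_le j ((h₂ j).1 hi) le_rfl
    · have hle (i : ℕ) (hi : Q i) : (((i + e : ℕ) : ℕ∞) : WithBot ℕ∞) ≤
          ⨆ (i : ℕ) (_ : P i), ((i : ℕ∞) : WithBot ℕ∞) :=
        le_iSup₂_of_le (i + e) ((h₂ i).2 hi) le_rfl
      generalize (⨆ (i : ℕ) (_ : P i), ((i : ℕ∞) : WithBot ℕ∞)) = T at hle
      obtain ⟨t, rfl⟩ : ∃ t : ℕ∞, (t : WithBot ℕ∞) = T :=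
        WithBot.ne_bot_iff_exists.1 fun h => by simpa [h] using hle i₀ hi₀
      have hle' (i : ℕ) (hi : Q i) : (i : ℕ∞) + e ≤ t := by
        simpa using WithBot.coe_le_coe.1 (hle i hi)
      have het : (e : ℕ∞) ≤ t := le_add_self.trans (hle' i₀ hi₀)
      calc _ ≤ ((t - e : ℕ∞) : WithBot ℕ∞) + ((e : ℕ∞) : WithBot ℕ∞) := by
            gcongr
            exact iSup₂_le fun i hi => WithBot.coe_le_coe.2
              (ENat.le_sub_of_add_le_right (ENat.natCast_ne_top e) (hle' i hi))
        _ = t := by rw [← WithBot.coe_add, tsub_add_cancel_of_le het]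
  · push Not at hQ
    have hP (i : ℕ) : ¬ P i := fun hi => by
      obtain ⟨j, rfl⟩ := Nat.exists_eq_add_of_le' (not_lt.1 fun h => h₁ i h hi)
      exact hQ j ((h₂ j).1 hi)
    simp [hP, hQ]

theorem proposition3p2 {R : Type u} [CommRing R] [IsNoetherianRing R]
    (I : Ideal R) (hI : I ≠ ⊤)
    (M N : Type u) [AddCommGroup M] [Module R M] [AddCommGroup N] [Module R N]
    [Module.Finite R M] (e : ℕ)
    (hExt : ∀ i : ℕ, i ≠ e → Subsingleton (GenLocalCohomology.ExtModule R M N i)) :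
    GenLocalCohomology.depthPair I M N =
        GenLocalCohomology.depth I (GenLocalCohomology.ExtModule R M N e) + (e : ℕ∞) ∧
      GenLocalCohomology.cdPair I M N =
        GenLocalCohomology.cd I (GenLocalCohomology.ExtModule R M N e) +
          ((e : ℕ∞) : WithBot ℕ∞) ∧
      (GenLocalCohomology.IsCohenMacaulay I (GenLocalCohomology.ExtModule R M N e) ↔
        GenLocalCohomology.IsCohenMacaulayPair I M N) := by
  obtain ⟨h₁, h₂⟩ := GenLocalCohomology.subsingleton_H_pair I M N e hExt
  simp only [← not_nontrivial_iff_subsingleton, not_iff_not] at h₁ h₂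
  have hdepth := iInf_shift _ _ e h₁ h₂
  have hcd := iSup_shift _ _ e h₁ h₂
  refine ⟨hdepth, hcd, ?_⟩
  change GenLocalCohomology.depthPair I M N = _ at hdepth
  change GenLocalCohomology.cdPair I M N = _ at hcd
  rw [GenLocalCohomology.IsCohenMacaulayPair, hdepth, hcd, WithBot.coe_add]
  refine ⟨fun h => congrArg (· + _) h, fun h => add_coe_natCast_cancel e h⟩
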